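/- **Definitions.** A *Steiner topology for $n$ terminals* is a finite tree with $n$ distinguished (labelled) vertices, called terminals, all of degree at most $3$, in which every other vertex, called a Steiner point, has degree exactly $3$; it is *full* if all terminals have degree $1$. A *Steiner tree* $T$ in $\mathbb{R}^d$ with this topology represents each vertex by a point of $\mathbb{R}^d$ (points may coincide) and each edge by the straight-line segment between its endpoints; its length $L(T)$ is the sum of the Euclidean lengths of its edges. For $\varepsilon\ge 0$, $T$ is *$\varepsilon$-approximate* if no edge has length $0$ and all angles spanned by two edges at a Steiner point lie in $[2\pi/3-\varepsilon,\,2\pi/3+\varepsilon]$. Let $S(T)$ denote a shortest tree in $\mathbb{R}^d$ with the same topology and the same terminal points as $T$, where edges of length $0$ are allowed. For $d\ge2$, $n\geq 3$ and $\varepsilon\ge0$ let $$F_d(\varepsilon,n)=\sup_T \frac{L(T)-L(S(T))}{L(S(T))}\in[0,\infty],$$ the supremum being over all full $\varepsilon$-approximate Steiner trees $T$ on $n$ terminals in $\mathbb{R}^d$. **Theorem.** For every integer $k\ge 1$, if $\varepsilon=c/k^2$ with $0<c<1$, then $$F_2(\varepsilon,2^k+1)>\frac{c}{24}\,\varepsilon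 .$$ Consequently, $F_2(\varepsilon,n)=\Omega((\log n)^2\varepsilon^2)$ for $\varepsilon<(\log_2 n)^{-2}$: there is an absolute constant $C>0$ such that for all integers $n\ge 3$ and all real $\varepsilon$ with $0\le\varepsilon<(\log_2 n)^{-2}$, $$F_2(\varepsilon,n)\ge C(\log n)^2\varepsilon^2 .$$ -/

import Mathlib

/-- A Steiner topology for `n` terminals: a finite tree with `n` distinct labelled vertices
(the terminals), all of degree at most `3`, all other vertices (the Steiner points) having
degree exactly `3`. -/
structure SteinerTopology (n : ℕ) where
  V : Type
  [fintypeV : Fintype V]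
  graph : SimpleGraph V
  isTree : graph.IsTree
  terminal : Fin n ↪ V
  terminal_degree : ∀ i, (graph.neighborSet (terminal i)).ncard ≤ 3
  steiner_degree : ∀ v, v ∉ Set.range terminal → (graph.neighborSet v).ncard = 3

attribute [instance] SteinerTopology.fintypeV

namespace SteinerTopology

/-- A Steiner topology is full if all terminals have degree `1`. -/
def IsFull {n : ℕ} (T : SteinerTopology n) : Prop :=
  ∀ i, (T.graph.neighborSet (T.terminal i)).ncard = 1

/-- A Steiner tree in `ℝ^d` with topology `T`: every vertex is represented by an arbitrary point
(points may coincide); the edges are the straight-line segments between adjacent vertices. -/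
abbrev Realization {n : ℕ} (T : SteinerTopology n) (d : ℕ) : Type :=
  T.V → EuclideanSpace ℝ (Fin d)

open Classical in
/-- The sum of the Euclidean lengths of the edges. -/
noncomputable def length {n d : ℕ} (T : SteinerTopology n) (p : T.Realization d) : ℝ :=
  ∑ e ∈ T.graph.edgeFinset,
    Sym2.lift ⟨fun u v => dist (p u) (p v), fun u v => dist_comm (p u) (p v)⟩ e

/-- `p` is an `ε`-approximate Steiner tree: no edge has length `0` (so that all angles are
defined), and every angle spanned by two edges at a Steiner point lies in
`[2π/3 - ε, 2π/3 + ε]`. -/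
def IsApproximate {n d : ℕ} (T : SteinerTopology n) (ε : ℝ) (p : T.Realization d) : Prop :=
  (∀ u v, T.graph.Adj u v → p u ≠ p v) ∧
  ∀ s, s ∉ Set.range T.terminal → ∀ u v, T.graph.Adj s u → T.graph.Adj s v → u ≠ v →
    EuclideanGeometry.angle (p u) (p s) (p v) ∈
      Set.Icc (2 * Real.pi / 3 - ε) (2 * Real.pi / 3 + ε)

/-- `s` is a shortest tree with the same topology and the same terminals as `p`; it may be
degenerate. -/
def IsShortestFor {n d : ℕ} (T : SteinerTopology n) (p s : T.Realization d) : Prop :=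
  (∀ i, s (T.terminal i) = p (T.terminal i)) ∧
  ∀ q : T.Realization d, (∀ i, q (T.terminal i) = p (T.terminal i)) → T.length s ≤ T.length q

end SteinerTopology

/-- `F_d(ε, n)`: the supremum, in the extended reals, of `(L(T) - L(S(T))) / L(S(T))` over all full
`ε`-approximate Steiner trees `T` on `n` terminals in `ℝ^d`. -/
noncomputable def steinerRelError (d : ℕ) (ε : ℝ) (n : ℕ) : EReal :=
  sSup {r : EReal | ∃ (T : SteinerTopology n) (p s : T.Realization d),
    T.IsFull ∧ T.IsApproximate ε p ∧ T.IsShortestFor p s ∧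
    r = (((T.length p - T.length s) / T.length s : ℝ) : EReal)}

/-! The example is a binary tree hanging from a terminal, with edges of length `2⁻ʲ` at depth `j`,
so each full level has total length `1`. In the untilted tree children branch off at `±π/3` and all
angles are `2π/3`. Rotating every edge of depth `j` by `(j - k/2)ε` changes the angles at a Steiner
point by `-ε`, `ε` and `0`, so the tilted tree is `ε`-approximate.

The tilted tree is compared with a tree on the same terminals whose edges have the untilted
directions. A vertex of depth `j` moves perpendicular to its untilted edge, by `2⁻ʲ` times the sum
of the sines of the rotations up to depth `j`. By antisymmetry this sum vanishes at depth `k`, so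
the terminals stay fixed (`tiltSin_last`). Each edge keeps its projection, up to a term with
opposite signs on siblings (`heapPos_sub_heapShift`). Hence exactly `∑ (1 - cos ((j - k/2)ε))` is
saved (`sum_dist_heapPos_sub`), about `k(k+1)(k+2)ε²/24`, out of a length of at most `k + 2`. This
gives a relative error of order `k²ε²`.

For general `n` the heap has `m = n - 1` leaves and `k = ⌊log₂ m⌋`; the incomplete level below depth
`k` is left unmoved. -/

namespace SteinerTopology

/-! ### Shortest trees and lower bounds for the relative error -/

variable {n d : ℕ} (T : SteinerTopology n)

theorem length_nonneg (p : T.Realization d) : 0 ≤ T.length p := by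
  classical
  refine Finset.sum_nonneg fun e _ => ?_
  induction e using Sym2.inductionOn with
  | hf u v => exact dist_nonneg (x := p u) (y := p v)

theorem dist_le_length (p : T.Realization d) {u v : T.V} (h : T.graph.Adj u v) :
    dist (p u) (p v) ≤ T.length p := by
  classical
  have hmem : s(u, v) ∈ T.graph.edgeFinset := by simpa using h
  refine Finset.single_le_sum (f := Sym2.lift ⟨fun u v => dist (p u) (p v),
    fun u v => dist_comm (p u) (p v)⟩) (fun e _ => ?_) hmem
  induction e using Sym2.inductionOn with
  | hf u v => exact dist_nonneg (x := p u) (y := p v)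

theorem continuous_length : Continuous fun p : T.Realization d => T.length p := by
  classical
  refine continuous_finsetSum _ fun e _ => ?_
  induction e using Sym2.inductionOn with
  | hf u v => exact Continuous.dist (α := EuclideanSpace ℝ (Fin d)) (continuous_apply u) (continuous_apply v)

theorem dist_le_walk_length_mul (p : T.Realization d) {u v : T.V} (w : T.graph.Walk u v) :
    dist (p u) (p v) ≤ w.length * T.length p := by
  induction w with
  | nil => simp
  | cons h w ih =>
    refine (dist_triangle _ _ _).trans ((add_le_add (T.dist_le_length p h) ih).trans ?_)
    rw [SimpleGraph.Walk.length_cons]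
    push_cast
    linarith

/-- Compactness: a tree no longer than `p` stays within bounded distance of a fixed terminal,
because the topology is connected. -/
theorem exists_isShortestFor (i : Fin n) (p : T.Realization d) :
    ∃ s : T.Realization d, T.IsShortestFor p s := by
  classical
  set K : Set (T.Realization d) :=
    {q | (∀ i, q (T.terminal i) = p (T.terminal i)) ∧ T.length q ≤ T.length p} with hK
  have hclosed : IsClosed K := by
    have : K = (⋂ i, {q | q (T.terminal i) = p (T.terminal i)}) ∩
        {q | T.length q ≤ T.length p} := by
      ext q; simp [hK]
    rw [this]
    exact (isClosed_iInter fun i => isClosed_eq (continuous_apply _) continuous_const).inter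
      (isClosed_le T.continuous_length continuous_const)
  have walk (v : T.V) : T.graph.Walk v (T.terminal i) := (T.isTree.connected v _).some
  have hcompact : IsCompact K := by
    refine (isCompact_univ_pi fun v => isCompact_closedBall (p (T.terminal i))
      ((walk v).length * T.length p)).of_isClosed_subset hclosed fun q hq v _ => ?_
    rw [Metric.mem_closedBall, ← hq.1 i]
    exact (T.dist_le_walk_length_mul q (walk v)).trans
      (mul_le_mul_of_nonneg_left hq.2 (Nat.cast_nonneg _))
  obtain ⟨s, hs, hmin⟩ := hcompact.exists_isMinOn ⟨p, fun _ => rfl, le_rfl⟩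
    T.continuous_length.continuousOn
  refine ⟨s, hs.1, fun q hq => ?_⟩
  by_cases hle : T.length q ≤ T.length p
  · exact hmin ⟨hq, hle⟩
  · exact hs.2.trans (not_le.1 hle).le

/-- Comparison with any realization `q` having the same terminals bounds the relative error
from below. -/
theorem le_steinerRelError {ε : ℝ} (hfull : T.IsFull) {p q : T.Realization d}
    (hp : T.IsApproximate ε p) (hq : ∀ i, q (T.terminal i) = p (T.terminal i))
    {i j : Fin n} {v : T.V} (hi : T.graph.Adj (T.terminal i) v)
    (hj : T.graph.Adj (T.terminal j) v) (hij : p (T.terminal i) ≠ p (T.terminal j))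
    {D K : ℝ} (hD0 : 0 ≤ D) (hD : D ≤ T.length p - T.length q) (hK : T.length q ≤ K) :
    ((D / K : ℝ) : EReal) ≤ steinerRelError d ε n := by
  obtain ⟨s, hs⟩ := T.exists_isShortestFor i p
  have hsq := hs.2 q hq
  have hpos : 0 < T.length s := by
    -- Length zero would collapse the two distinct terminals onto their common neighbour.
    refine lt_of_le_of_ne (T.length_nonneg s) fun h0 => hij ?_
    have h1 := T.dist_le_length s hi
    have h2 := T.dist_le_length s hj
    rw [← h0, dist_le_zero] at h1 h2
    rw [← hs.1 i, ← hs.1 j, h1, h2]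
  refine le_trans ?_ (le_sSup ⟨T, p, s, hfull, hp, hs, rfl⟩)
  rw [EReal.coe_le_coe_iff]
  exact div_le_div₀ (by linarith) (by linarith) hpos (by linarith)

end SteinerTopology

/-! ### The heap as a full Steiner topology -/

/-- The graph on `0, …, 2m - 1` in which each `i ≥ 1` is joined to `i / 2`. -/
def heapGraph (m : ℕ) : SimpleGraph (Fin (2 * m)) where
  Adj u v := u ≠ v ∧ (v.val = u.val / 2 ∨ u.val = v.val / 2)
  symm := ⟨fun _ _ h => ⟨h.1.symm, h.2.symm⟩⟩
  loopless := ⟨fun _ h => h.1 rfl⟩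

theorem heapGraph_adj {m : ℕ} {u v : Fin (2 * m)} :
    (heapGraph m).Adj u v ↔ u ≠ v ∧ (v.val = u.val / 2 ∨ u.val = v.val / 2) := Iff.rfl

/-- The parent `i / 2` of a vertex `i`. -/
def heapParent {m : ℕ} (i : Fin (2 * m)) : Fin (2 * m) :=
  ⟨i.val / 2, (Nat.div_le_self _ _).trans_lt i.isLt⟩

theorem heapGraph_adj_parent {m : ℕ} {i : Fin (2 * m)} (hi : i.val ≠ 0) :
    (heapGraph m).Adj i (heapParent i) := by
  refine ⟨fun h => ?_, Or.inl rfl⟩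
  have := congrArg Fin.val h
  simp only [heapParent] at this
  omega

theorem heapGraph_edgeSet (m : ℕ) :
    (heapGraph m).edgeSet = (fun i => s(i, heapParent i)) '' {i : Fin (2 * m) | i.val ≠ 0} := by
  ext e
  induction e using Sym2.inductionOn with
  | hf u v =>
    simp only [SimpleGraph.mem_edgeSet, Set.mem_image, Set.mem_ofPred_eq, Sym2.eq_iff]
    constructor
    · rintro ⟨hne, h | h⟩
      · exact ⟨u, fun h0 => hne (Fin.ext (by omega)), Or.inl ⟨rfl, Fin.ext h.symm⟩⟩
      · exact ⟨v, fun h0 => hne (Fin.ext (by omega)), Or.inr ⟨rfl, Fin.ext h.symm⟩⟩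
    · rintro ⟨i, hi, ⟨rfl, rfl⟩ | ⟨rfl, rfl⟩⟩
      · exact heapGraph_adj_parent hi
      · exact (heapGraph_adj_parent hi).symm

theorem heapParent_edge_injOn (m : ℕ) :
    Set.InjOn (fun i => s(i, heapParent i)) {i : Fin (2 * m) | i.val ≠ 0} := by
  intro i hi j hj h
  simp only [Sym2.eq_iff, heapParent, Fin.ext_iff, Set.mem_ofPred_eq] at h hi hj ⊢
  omega

/-- Repeated halving leads to `0`, and sending `i ≠ 0` to its parent edge counts `2m - 1` edges. -/
theorem heapGraph_isTree {m : ℕ} (hm : 0 < m) : (heapGraph m).IsTree := by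
  have hroot : ∀ N (i : Fin (2 * m)), i.val = N →
      (heapGraph m).Reachable i ⟨0, by omega⟩ := by
    intro N
    induction N using Nat.strong_induction_on with
    | _ N ih =>
      intro i hi
      by_cases h0 : i.val = 0
      · rw [show i = ⟨0, by omega⟩ from Fin.ext h0]
      · exact (heapGraph_adj_parent h0).reachable.trans
          (ih (i.val / 2) (by omega) (heapParent i) rfl)
  rw [SimpleGraph.isTree_iff_connected_and_card]
  have : Nonempty (Fin (2 * m)) := ⟨⟨0, by omega⟩⟩
  refine ⟨⟨fun u v => (hroot _ u rfl).trans (hroot _ v rfl).symm⟩, ?_⟩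
  rw [heapGraph_edgeSet, Nat.card_coe_set_eq, (heapParent_edge_injOn m).ncard_image]
  have hset : {i : Fin (2 * m) | i.val ≠ 0} = {(⟨0, by omega⟩ : Fin (2 * m))}ᶜ := by
    ext i; simp [Fin.ext_iff]
  have := Set.ncard_add_ncard_compl {(⟨0, by omega⟩ : Fin (2 * m))}
  rw [Set.ncard_singleton] at this
  rw [hset]
  omega

theorem heapGraph_neighborSet_zero {m : ℕ} (hm : 0 < m) {i : Fin (2 * m)} (hi : i.val = 0) :
    (heapGraph m).neighborSet i = {⟨1, by omega⟩} := by
  ext v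
  simp only [SimpleGraph.mem_neighborSet, heapGraph_adj, Set.mem_singleton_iff, Fin.ext_iff, ne_eq]
  omega

theorem heapGraph_neighborSet_leaf {m : ℕ} {i : Fin (2 * m)} (hi : m ≤ i.val) :
    (heapGraph m).neighborSet i = {heapParent i} := by
  ext v
  have := v.isLt
  simp only [SimpleGraph.mem_neighborSet, heapGraph_adj, Set.mem_singleton_iff, Fin.ext_iff, ne_eq,
    heapParent]
  omega

theorem heapGraph_adj_internal {m : ℕ} {i v : Fin (2 * m)} (h0 : i.val ≠ 0) :
    (heapGraph m).Adj i v ↔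
      v.val = i.val / 2 ∨ v.val = 2 * i.val ∨ v.val = 2 * i.val + 1 := by
  simp only [heapGraph_adj, Fin.ext_iff, ne_eq]
  omega

theorem heapGraph_ncard_internal {m : ℕ} {i : Fin (2 * m)} (h0 : i.val ≠ 0) (hi : i.val < m) :
    ((heapGraph m).neighborSet i).ncard = 3 := by
  rw [Set.ncard_eq_three]
  refine ⟨heapParent i, ⟨2 * i.val, by omega⟩, ⟨2 * i.val + 1, by omega⟩, ?_, ?_, ?_, ?_⟩
  · simp only [heapParent, Fin.ext_iff, ne_eq]; omega
  · simp only [heapParent, Fin.ext_iff, ne_eq]; omega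
  · simp only [Fin.ext_iff, ne_eq]; omega
  · ext v
    simp [heapGraph_adj_internal h0, heapParent, Fin.ext_iff]

/-- The terminals of the heap: the vertex `0` and the leaves `m, …, 2m - 1`. -/
def heapTerminal (m : ℕ) (hm : 0 < m) : Fin (m + 1) ↪ Fin (2 * m) where
  toFun i := ⟨if i.val = 0 then 0 else m + i.val - 1, by split_ifs <;> omega⟩
  inj' i j h := by
    simp only [Fin.ext_iff] at h ⊢
    split_ifs at h <;> omega

theorem heapTerminal_val {m : ℕ} (hm : 0 < m) (i : Fin (m + 1)) :
    (heapTerminal m hm i).val = if i.val = 0 then 0 else m + i.val - 1 := rfl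

theorem mem_range_heapTerminal {m : ℕ} (hm : 0 < m) (v : Fin (2 * m)) :
    v ∈ Set.range (heapTerminal m hm) ↔ v.val = 0 ∨ m ≤ v.val := by
  have := v.isLt
  constructor
  · rintro ⟨i, rfl⟩
    rw [heapTerminal_val]
    split_ifs <;> omega
  · rintro (h | h)
    · exact ⟨⟨0, by omega⟩, Fin.ext (by rw [heapTerminal_val, h]; rfl)⟩
    · refine ⟨⟨v.val - m + 1, by omega⟩, Fin.ext ?_⟩
      rw [heapTerminal_val]
      simp only [Nat.add_eq_zero_iff, one_ne_zero, and_false, if_false]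
      omega

theorem heapGraph_ncard_terminal {m : ℕ} (hm : 0 < m) (i : Fin (m + 1)) :
    ((heapGraph m).neighborSet (heapTerminal m hm i)).ncard = 1 := by
  rcases (mem_range_heapTerminal hm _).1 ⟨i, rfl⟩ with h | h
  · rw [heapGraph_neighborSet_zero hm h, Set.ncard_singleton]
  · rw [heapGraph_neighborSet_leaf h, Set.ncard_singleton]

/-- The full Steiner topology of an almost complete binary tree with `m` leaves, hanging from a
terminal. -/
def heapTopology (m : ℕ) (hm : 0 < m) : SteinerTopology (m + 1) where
  V := Fin (2 * m)
  graph := heapGraph m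
  isTree := heapGraph_isTree hm
  terminal := heapTerminal m hm
  terminal_degree i := by rw [heapGraph_ncard_terminal hm i]; norm_num
  steiner_degree v hv := by
    rw [mem_range_heapTerminal, not_or, not_le] at hv
    exact heapGraph_ncard_internal hv.1 hv.2

theorem heapTopology_isFull {m : ℕ} (hm : 0 < m) : (heapTopology m hm).IsFull :=
  heapGraph_ncard_terminal hm

theorem heapGraph_sum_edgeFinset (m : ℕ) [Fintype (heapGraph m).edgeSet]
    (f : Sym2 (Fin (2 * m)) → ℝ) :
    ∑ e ∈ (heapGraph m).edgeFinset, f e =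
      ∑ i : Fin (2 * m) with i.val ≠ 0, f s(i, heapParent i) := by
  have hE : (heapGraph m).edgeFinset =
      (Finset.univ.filter fun i : Fin (2 * m) => i.val ≠ 0).image
        (fun i => s(i, heapParent i)) := by
    rw [← Finset.coe_inj, SimpleGraph.coe_edgeFinset, heapGraph_edgeSet]
    simp
  rw [hE, Finset.sum_image fun i hi j hj h =>
    heapParent_edge_injOn m (by simpa using hi) (by simpa using hj) h]

theorem heapTopology_length {m d : ℕ} (hm : 0 < m) (p : ℕ → EuclideanSpace ℝ (Fin d)) :
    (heapTopology m hm).length (fun i : Fin (2 * m) => p i.val) =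
      ∑ i ∈ Finset.Ico 1 (2 * m), dist (p i) (p (i / 2)) := by
  classical
  refine (heapGraph_sum_edgeFinset m _).trans ?_
  refine Finset.sum_bij (fun i _ => i.val) (fun i hi => ?_) (fun i _ j _ h => Fin.ext h)
    (fun j hj => ?_) (fun i _ => rfl)
  · have := i.isLt
    simp only [Finset.mem_filter, Finset.mem_univ, true_and] at hi
    exact Finset.mem_Ico.2 ⟨by omega, this⟩
  · rw [Finset.mem_Ico] at hj
    refine ⟨⟨j, hj.2⟩, ?_, rfl⟩
    simp only [Finset.mem_filter, Finset.mem_univ, true_and]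
    omega

/-! ### Estimates for the rotations -/

/-- The rotation of the edges of depth `j` of the heap. -/
noncomputable def tilt (k : ℕ) (ε : ℝ) (j : ℕ) : ℝ := (j - k / 2) * ε

/-- Partial sums of the sines of the rotations. -/
noncomputable def tiltSin (k : ℕ) (ε : ℝ) (j : ℕ) : ℝ :=
  ∑ l ∈ Finset.range j, Real.sin (tilt k ε l)

theorem tilt_succ (k : ℕ) (ε : ℝ) (j : ℕ) : tilt k ε (j + 1) = tilt k ε j + ε := by
  simp only [tilt]; push_cast; ring

theorem tilt_reflect {k : ℕ} (ε : ℝ) {j : ℕ} (hj : j ≤ k) : tilt k ε (k - j) = -tilt k ε j := by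
  simp only [tilt]; push_cast [hj]; ring

theorem abs_tilt_le {k : ℕ} {ε : ℝ} (hε : 0 ≤ ε) {j : ℕ} (hj : j ≤ k) :
    |tilt k ε j| ≤ k * ε / 2 := by
  have h1 : (j : ℝ) ≤ k := by exact_mod_cast hj
  have h0 : (0 : ℝ) ≤ j := Nat.cast_nonneg j
  rw [tilt, abs_mul, abs_of_nonneg hε]
  have : |(j : ℝ) - k / 2| ≤ k / 2 := abs_le.2 ⟨by linarith, by linarith⟩
  nlinarith

theorem tiltSin_zero (k : ℕ) (ε : ℝ) : tiltSin k ε 0 = 0 := by simp [tiltSin]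

theorem tiltSin_succ (k : ℕ) (ε : ℝ) (j : ℕ) :
    tiltSin k ε (j + 1) = tiltSin k ε j + Real.sin (tilt k ε j) := Finset.sum_range_succ _ _

/-- The rotations are centred at `k/2` for this: the terms `j` and `k - j` cancel, so depth `k` is
not displaced. -/
theorem tiltSin_last (k : ℕ) (ε : ℝ) : tiltSin k ε (k + 1) = 0 := by
  have h := Finset.sum_range_reflect (fun l => Real.sin (tilt k ε l)) (k + 1)
  have h' : ∑ j ∈ Finset.range (k + 1), Real.sin (tilt k ε (k + 1 - 1 - j)) =
      -tiltSin k ε (k + 1) := by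
    rw [tiltSin, ← Finset.sum_neg_distrib]
    refine Finset.sum_congr rfl fun j hj => ?_
    rw [Nat.add_sub_cancel, tilt_reflect ε (Nat.lt_succ_iff.1 (Finset.mem_range.1 hj)),
      Real.sin_neg]
  rw [h'] at h
  change _ = tiltSin k ε (k + 1) at h
  linarith

theorem abs_sum_sin_tilt_le {k : ℕ} {ε : ℝ} (hε : 0 ≤ ε) {s : Finset ℕ} (hs : ∀ j ∈ s, j ≤ k) :
    |∑ l ∈ s, Real.sin (tilt k ε l)| ≤ s.card * (k * ε / 2) := by
  refine (Finset.abs_sum_le_sum_abs _ _).trans ?_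
  rw [← nsmul_eq_mul]
  exact Finset.sum_le_card_nsmul _ _ _ fun j hj =>
    Real.abs_sin_le_abs.trans (abs_tilt_le hε (hs j hj))

/-- As the full sum is zero, head and tail have equal absolute value; the bounds for the two are
added. -/
theorem two_mul_abs_tiltSin_le {k : ℕ} {ε : ℝ} (hε : 0 ≤ ε) {j : ℕ} (hj : j ≤ k + 1) :
    2 * |tiltSin k ε j| ≤ (k + 1) * (k * ε / 2) := by
  have h1 : |tiltSin k ε j| ≤ j * (k * ε / 2) := by
    have := abs_sum_sin_tilt_le (k := k) hε (s := Finset.range j)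
      fun l hl => by have := Finset.mem_range.1 hl; omega
    rwa [Finset.card_range] at this
  have h2 : |tiltSin k ε j| ≤ (k + 1 - j) * (k * ε / 2) := by
    have := abs_sum_sin_tilt_le (k := k) hε (s := Finset.Ico j (k + 1))
      fun l hl => by have := Finset.mem_Ico.1 hl; omega
    rw [Nat.card_Ico] at this
    have hs := Finset.sum_range_add_sum_Ico (fun l => Real.sin (tilt k ε l)) hj
    change tiltSin k ε j + _ = tiltSin k ε (k + 1) at hs
    rw [tiltSin_last] at hs
    rw [eq_neg_of_add_eq_zero_left hs, abs_neg]
    push_cast [hj] at this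
    exact this
  linarith

theorem mul_le_one_of_sq_mul {k : ℕ} {ε : ℝ} (hk : 1 ≤ k) (h : ε * k ^ 2 ≤ 1) :
    k * ε ≤ 1 := by
  have : (1 : ℝ) ≤ k := by exact_mod_cast hk
  nlinarith

/-- Guarantees that no edge of the comparison tree gets a negative signed length. This is where `ε
k² ≤ 1` is essential. -/
theorem abs_sqrt_three_mul_tiltSin_le {k : ℕ} {ε : ℝ} (hk : 1 ≤ k) (hε : 0 ≤ ε)
    (h : ε * k ^ 2 ≤ 1) {j : ℕ} (hj : j ≤ k) :
    |√3 * tiltSin k ε j| ≤ Real.cos (tilt k ε j) := by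
  have hk' : (1 : ℝ) ≤ k := by exact_mod_cast hk
  have h1 := mul_le_one_of_sq_mul hk h
  have h2 := two_mul_abs_tiltSin_le hε (hj.trans (Nat.le_succ k))
  have h3 := abs_tilt_le hε hj
  have h4 := Real.one_sub_sq_div_two_le_cos (x := tilt k ε j)
  have h5 : tilt k ε j ^ 2 ≤ (1 / 2) ^ 2 := by
    rw [← sq_abs]
    exact pow_le_pow_left₀ (abs_nonneg _) (by linarith) 2
  -- `7/4 · 1/2 = 7/8 = 1 - (1/2)²/2`, which is the lower bound for the cosine.
  have h6 : √3 ≤ 7 / 4 := by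
    rw [Real.sqrt_le_left (by norm_num)]; norm_num
  have h7 : |tiltSin k ε j| ≤ 1 / 2 := by nlinarith
  rw [abs_mul, abs_of_nonneg (Real.sqrt_nonneg 3)]
  nlinarith [abs_nonneg (tiltSin k ε j), Real.sqrt_nonneg 3]

theorem sum_sq_tilt (k : ℕ) (ε : ℝ) :
    ∑ j ∈ Finset.range (k + 1), tilt k ε j ^ 2 = k * (k + 1) * (k + 2) / 12 * ε ^ 2 := by
  -- The centre is decoupled from the number of terms so that induction applies.
  have key : ∀ (c : ℝ) (N : ℕ), ∑ j ∈ Finset.range (N + 1), ((j - c) * ε) ^ 2 =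
      (N * (N + 1) * (2 * N + 1) / 6 - c * N * (N + 1) + (N + 1) * c ^ 2) * ε ^ 2 := by
    intro c N
    induction N with
    | zero => simp; ring
    | succ N ih => rw [Finset.sum_range_succ, ih]; push_cast; ring
  simp only [tilt]
  rw [key]; ring

/-- The quartic error `5/96 · x⁴` of `Real.cos_bound` is absorbed using `x² ≤ 1/(4k)`. -/
theorem one_sub_cos_tilt_ge {k : ℕ} {ε : ℝ} (hk : 1 ≤ k) (hε : 0 ≤ ε) (h : ε * k ^ 2 ≤ 1)
    {j : ℕ} (hj : j ≤ k) :
    (1 - 5 / (192 * k)) / 2 * tilt k ε j ^ 2 ≤ 1 - Real.cos (tilt k ε j) := by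
  have hk' : (1 : ℝ) ≤ k := by exact_mod_cast hk
  have h1 := mul_le_one_of_sq_mul hk h
  have h3 := abs_tilt_le hε hj
  have h4 := (abs_le.1 (Real.cos_bound (x := tilt k ε j) (by linarith))).2
  have h5 : tilt k ε j ^ 2 ≤ 1 / (4 * k) := by
    have : tilt k ε j ^ 2 ≤ (k * ε / 2) ^ 2 := by
      rw [← sq_abs]; exact pow_le_pow_left₀ (abs_nonneg _) h3 2
    refine this.trans ?_
    rw [le_div_iff₀ (by positivity)]
    nlinarith [mul_nonneg hε (by linarith : (0 : ℝ) ≤ k)]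
  have h6 : |tilt k ε j| ^ 4 ≤ tilt k ε j ^ 2 * (1 / (4 * k)) := by
    rw [show |tilt k ε j| ^ 4 = (|tilt k ε j| ^ 2) ^ 2 by ring, sq_abs, sq]
    exact mul_le_mul_of_nonneg_left h5 (sq_nonneg _)
  have h7 : (1 - 5 / (192 * (k : ℝ))) / 2 * tilt k ε j ^ 2 =
      tilt k ε j ^ 2 / 2 - tilt k ε j ^ 2 * (1 / (4 * k)) * (5 / 96) := by
    field_simp; ring
  rw [h7]
  linarith

theorem sum_one_sub_cos_tilt_ge {k : ℕ} {ε : ℝ} (hk : 1 ≤ k) (hε : 0 ≤ ε) (h : ε * k ^ 2 ≤ 1) :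
    k * (k + 1) ^ 2 * ε ^ 2 / 24 ≤
      ∑ j ∈ Finset.range (k + 1), (1 - Real.cos (tilt k ε j)) := by
  have hk' : (1 : ℝ) ≤ k := by exact_mod_cast hk
  refine le_trans ?_ (Finset.sum_le_sum fun j hj =>
    one_sub_cos_tilt_ge hk hε h (Nat.lt_succ_iff.1 (Finset.mem_range.1 hj)))
  rw [← Finset.mul_sum, sum_sq_tilt]
  -- The quartic loss is paid for by weakening the factor `k + 2` to `k + 1`.
  have h1 : (k : ℝ) + 1 ≤ (1 - 5 / (192 * k)) * (k + 2) := by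
    have : 5 / (192 * (k : ℝ)) * (k + 2) ≤ 1 := by
      rw [div_mul_eq_mul_div, div_le_one (by positivity)]; linarith
    linarith
  have h2 := mul_le_mul_of_nonneg_left h1 (by positivity : 0 ≤ (k : ℝ) * (k + 1) * ε ^ 2 / 24)
  calc _ = (k : ℝ) * (k + 1) * ε ^ 2 / 24 * (k + 1) := by ring
    _ ≤ _ := h2
    _ = _ := by ring

/-! ### Sums over the levels of the heap -/

theorem sum_Ico_two_pow {f : ℕ → ℝ} (N : ℕ) :
    ∑ i ∈ Finset.Ico 1 (2 ^ N), f i =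
      ∑ j ∈ Finset.range N, ∑ i ∈ Finset.Ico (2 ^ j) (2 ^ (j + 1)), f i := by
  induction N with
  | zero => simp
  | succ N ih =>
    rw [Finset.sum_range_succ, ← ih, Finset.sum_Ico_consecutive _ Nat.one_le_two_pow
      (Nat.pow_le_pow_right two_pos N.le_succ)]

theorem sum_Ico_neg_one_pow (a b : ℕ) : ∑ i ∈ Finset.Ico (2 * a) (2 * b), (-1 : ℝ) ^ i = 0 := by
  rcases le_or_gt b a with h | h
  · simp [h]
  · induction b, h using Nat.le_induction with
    | base =>
      rw [show 2 * a.succ = 2 * a + 1 + 1 by omega, Finset.sum_Ico_succ_top (by omega),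
        Finset.sum_Ico_succ_top (by omega)]
      simp [pow_succ]
    | succ b hb ih =>
      have : a < b := hb
      rw [show 2 * (b + 1) = 2 * b + 1 + 1 by omega, Finset.sum_Ico_succ_top (by omega),
        Finset.sum_Ico_succ_top (by omega), ih]
      simp [pow_succ]

theorem log_of_mem_Ico {i j : ℕ} (h : i ∈ Finset.Ico (2 ^ j) (2 ^ (j + 1))) :
    Nat.log 2 i = j := by
  rw [Finset.mem_Ico] at h
  exact Nat.log_eq_of_pow_le_of_lt_pow h.1 h.2

theorem sum_Ico_inv_two_pow_log (N : ℕ) :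
    ∑ i ∈ Finset.Ico 1 (2 ^ N), ((2 : ℝ) ^ Nat.log 2 i)⁻¹ = N := by
  rw [sum_Ico_two_pow, ← Finset.card_range N, Finset.cast_card, Finset.card_range]
  refine Finset.sum_congr rfl fun j _ => ?_
  rw [Finset.sum_congr rfl fun i hi => by rw [log_of_mem_Ico hi]]
  rw [Finset.sum_const, Nat.card_Ico, nsmul_eq_mul, pow_succ, mul_two, Nat.add_sub_cancel]
  push_cast
  exact mul_inv_cancel₀ (by positivity)

/-! ### Positions and angles of the tilted heap -/

open Complex in
theorem Complex.angle_mul_exp {r s a b : ℝ} (hr : 0 < r) (hs : 0 < s) (hab : |a - b| < Real.pi) :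
    InnerProductGeometry.angle (r * exp (a * I)) (s * exp (b * I)) = |a - b| := by
  rw [← real_smul (x := r), ← real_smul (x := s), InnerProductGeometry.angle_smul_left_of_pos _ _ hr,
    InnerProductGeometry.angle_smul_right_of_pos _ _ hs, angle_exp_exp,
    (toIocMod_eq_self Real.two_pi_pos).2]
  have := abs_lt.1 hab
  constructor <;> linarith

/-- The direction, as an argument, of the edge from `i / 2` to `i` of the untilted heap: the two
children branch off at `± π / 3`. -/
noncomputable def heapArg : ℕ → ℝ
  | 0 => 0
  | i + 1 => heapArg ((i + 1) / 2) + (-1) ^ (i + 1) * (Real.pi / 3)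
termination_by i => i
decreasing_by omega

theorem heapArg_of_ne_zero {i : ℕ} (hi : i ≠ 0) :
    heapArg i = heapArg (i / 2) + (-1) ^ i * (Real.pi / 3) := by
  obtain ⟨i, rfl⟩ := Nat.exists_eq_succ_of_ne_zero hi
  rw [heapArg]

theorem heapArg_two_mul {i : ℕ} (hi : i ≠ 0) : heapArg (2 * i) = heapArg i + Real.pi / 3 := by
  rw [heapArg_of_ne_zero (by omega), Nat.mul_div_cancel_left _ two_pos]
  simp

theorem heapArg_two_mul_add_one (i : ℕ) : heapArg (2 * i + 1) = heapArg i - Real.pi / 3 := by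
  rw [heapArg_of_ne_zero (by omega), show (2 * i + 1) / 2 = i by omega]
  simp [pow_succ]
  ring

theorem log_two_mul {i : ℕ} (hi : i ≠ 0) : Nat.log 2 (2 * i) = Nat.log 2 i + 1 := by
  rw [mul_comm, Nat.log_mul_base one_lt_two hi]

theorem log_two_mul_add_one {i : ℕ} (hi : i ≠ 0) : Nat.log 2 (2 * i + 1) = Nat.log 2 i + 1 := by
  rw [Nat.log_of_one_lt_of_le one_lt_two (by omega), show (2 * i + 1) / 2 = i by omega]

/-- The argument of the edge from `i / 2` to `i` of the tilted heap. -/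
noncomputable def heapPhase (k : ℕ) (ε : ℝ) (i : ℕ) : ℝ := heapArg i + tilt k ε (Nat.log 2 i)

theorem heapPhase_two_mul (k : ℕ) (ε : ℝ) {i : ℕ} (hi : i ≠ 0) :
    heapPhase k ε (2 * i) = heapPhase k ε i + Real.pi / 3 + ε := by
  rw [heapPhase, heapPhase, heapArg_two_mul hi, log_two_mul hi, tilt_succ]; ring

theorem heapPhase_two_mul_add_one (k : ℕ) (ε : ℝ) {i : ℕ} (hi : i ≠ 0) :
    heapPhase k ε (2 * i + 1) = heapPhase k ε i - Real.pi / 3 + ε := by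
  rw [heapPhase, heapPhase, heapArg_two_mul_add_one, log_two_mul_add_one hi, tilt_succ]; ring

/-- The length of the edge from `i / 2` to `i`. -/
noncomputable def heapEdgeLength (i : ℕ) : ℝ := ((2 : ℝ) ^ Nat.log 2 i)⁻¹

theorem heapEdgeLength_pos (i : ℕ) : 0 < heapEdgeLength i := by unfold heapEdgeLength; positivity

open Complex in
/-- The positions of the vertices of the tilted heap. -/
noncomputable def heapPos (k : ℕ) (ε : ℝ) : ℕ → ℂ
  | 0 => 0
  | i + 1 => heapPos k ε ((i + 1) / 2) +
      heapEdgeLength (i + 1) * exp (heapPhase k ε (i + 1) * I)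
termination_by i => i
decreasing_by omega

section

open Complex

theorem heapPos_sub {k : ℕ} {ε : ℝ} {i : ℕ} (hi : i ≠ 0) :
    heapPos k ε i - heapPos k ε (i / 2) = heapEdgeLength i * exp (heapPhase k ε i * I) := by
  obtain ⟨i, rfl⟩ := Nat.exists_eq_succ_of_ne_zero hi
  rw [heapPos, add_sub_cancel_left]

theorem heapPos_sub_two_mul {k : ℕ} {ε : ℝ} {i : ℕ} (hi : i ≠ 0) :
    heapPos k ε (2 * i) - heapPos k ε i =
      heapEdgeLength (2 * i) * exp ((heapPhase k ε i + Real.pi / 3 + ε : ℝ) * I) := by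
  have := heapPos_sub (k := k) (ε := ε) (i := 2 * i) (by omega)
  rwa [Nat.mul_div_cancel_left _ two_pos, heapPhase_two_mul k ε hi] at this

theorem heapPos_sub_two_mul_add_one {k : ℕ} {ε : ℝ} {i : ℕ} (hi : i ≠ 0) :
    heapPos k ε (2 * i + 1) - heapPos k ε i =
      heapEdgeLength (2 * i + 1) * exp ((heapPhase k ε i - Real.pi / 3 + ε : ℝ) * I) := by
  have := heapPos_sub (k := k) (ε := ε) (i := 2 * i + 1) (by omega)
  rwa [show (2 * i + 1) / 2 = i by omega, heapPhase_two_mul_add_one k ε hi] at this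

theorem dist_heapPos {k : ℕ} {ε : ℝ} {i : ℕ} (hi : i ≠ 0) :
    dist (heapPos k ε i) (heapPos k ε (i / 2)) = heapEdgeLength i := by
  rw [dist_eq, heapPos_sub hi, norm_mul, norm_exp_ofReal_mul_I, mul_one, norm_real,
    Real.norm_of_nonneg (heapEdgeLength_pos i).le]

/-- Both arguments `a ± π` of the reversed edge are needed: one for each child, so that the
difference of arguments stays below `π` in absolute value. -/
theorem neg_exp_eq_add_pi (a : ℝ) : -exp (a * I) = exp ((a + Real.pi : ℝ) * I) := by
  push_cast
  rw [add_mul, exp_add, exp_pi_mul_I, mul_neg_one]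

theorem neg_exp_eq_sub_pi (a : ℝ) : -exp (a * I) = exp ((a - Real.pi : ℝ) * I) := by
  push_cast
  rw [sub_mul, exp_sub, exp_pi_mul_I, div_neg, div_one]

theorem heapPos_parent_sub {k : ℕ} {ε : ℝ} {i : ℕ} (hi : i ≠ 0) :
    heapPos k ε (i / 2) - heapPos k ε i = heapEdgeLength i * -exp (heapPhase k ε i * I) := by
  rw [← neg_sub, heapPos_sub hi, mul_neg]

theorem angle_heapPos_children {k : ℕ} {ε : ℝ} {i : ℕ} (hi : i ≠ 0) :
    EuclideanGeometry.angle (heapPos k ε (2 * i)) (heapPos k ε i) (heapPos k ε (2 * i + 1)) =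
      2 * Real.pi / 3 := by
  have hpi := Real.pi_pos
  have h : heapPhase k ε i + Real.pi / 3 + ε - (heapPhase k ε i - Real.pi / 3 + ε) =
    2 * Real.pi / 3 := by ring
  have h' : |2 * Real.pi / 3| = 2 * Real.pi / 3 := abs_of_pos (by linarith)
  rw [EuclideanGeometry.angle, vsub_eq_sub, vsub_eq_sub, heapPos_sub_two_mul hi,
    heapPos_sub_two_mul_add_one hi, angle_mul_exp (heapEdgeLength_pos _) (heapEdgeLength_pos _)]
    <;> rw [h, h']
  linarith

theorem angle_heapPos_left {k : ℕ} {ε : ℝ} (h0 : 0 ≤ ε) (h1 : ε ≤ 1) {i : ℕ} (hi : i ≠ 0) :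
    EuclideanGeometry.angle (heapPos k ε (i / 2)) (heapPos k ε i) (heapPos k ε (2 * i)) =
      2 * Real.pi / 3 - ε := by
  have hpi := Real.pi_gt_three
  have h : heapPhase k ε i + Real.pi - (heapPhase k ε i + Real.pi / 3 + ε) =
    2 * Real.pi / 3 - ε := by ring
  have h' : |2 * Real.pi / 3 - ε| = 2 * Real.pi / 3 - ε := abs_of_pos (by linarith)
  rw [EuclideanGeometry.angle, vsub_eq_sub, vsub_eq_sub, heapPos_sub_two_mul hi,
    heapPos_parent_sub hi, neg_exp_eq_add_pi,
    angle_mul_exp (heapEdgeLength_pos _) (heapEdgeLength_pos _)] <;> rw [h, h']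
  linarith

theorem angle_heapPos_right {k : ℕ} {ε : ℝ} (h0 : 0 ≤ ε) (h1 : ε < 1) {i : ℕ} (hi : i ≠ 0) :
    EuclideanGeometry.angle (heapPos k ε (i / 2)) (heapPos k ε i) (heapPos k ε (2 * i + 1)) =
      2 * Real.pi / 3 + ε := by
  have hpi := Real.pi_gt_three
  have h : heapPhase k ε i - Real.pi - (heapPhase k ε i - Real.pi / 3 + ε) =
    -(2 * Real.pi / 3 + ε) := by ring
  have h' : |2 * Real.pi / 3 + ε| = 2 * Real.pi / 3 + ε := abs_of_pos (by linarith)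
  rw [EuclideanGeometry.angle, vsub_eq_sub, vsub_eq_sub, heapPos_sub_two_mul_add_one hi,
    heapPos_parent_sub hi, neg_exp_eq_sub_pi,
    angle_mul_exp (heapEdgeLength_pos _) (heapEdgeLength_pos _)] <;> rw [h, abs_neg, h']
  linarith

theorem heapPos_children_ne {k : ℕ} {ε : ℝ} {i : ℕ} (hi : i ≠ 0) :
    heapPos k ε (2 * i) ≠ heapPos k ε (2 * i + 1) := by
  intro h
  have hangle := angle_heapPos_children (k := k) (ε := ε) hi
  rw [← h, EuclideanGeometry.angle_self_of_ne] at hangle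
  · linarith [Real.pi_pos]
  · rw [← sub_ne_zero, heapPos_sub_two_mul hi]
    exact mul_ne_zero (ofReal_ne_zero.2 (heapEdgeLength_pos _).ne') (exp_ne_zero _)

/-! ### The untilted comparison tree and the length saved -/

/-- The displacement of the tilted heap from the Steiner minimal tree. -/
noncomputable def heapShift (k : ℕ) (ε : ℝ) (i : ℕ) : ℂ :=
  if i = 0 ∨ 2 ^ k ≤ i then 0
  else heapEdgeLength i * tiltSin k ε (Nat.log 2 i + 1) * (I * exp (heapArg i * I))

/-- At depth `k` the formula agrees with the default value `0`, by `tiltSin_last`. -/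
theorem heapShift_eq (k : ℕ) (ε : ℝ) {i : ℕ} (h0 : i ≠ 0) (hi : i < 2 ^ (k + 1)) :
    heapShift k ε i =
      heapEdgeLength i * tiltSin k ε (Nat.log 2 i + 1) * (I * exp (heapArg i * I)) := by
  rw [heapShift]
  split_ifs with h
  · have hk : Nat.log 2 i = k :=
      Nat.log_eq_of_pow_le_of_lt_pow (h.resolve_left h0) hi
    rw [hk, tiltSin_last]; simp
  · rfl

theorem exp_pi_div_three : exp ((Real.pi / 3 : ℝ) * I) = 1 / 2 + √3 / 2 * I := by
  rw [exp_mul_I, ← ofReal_cos, ← ofReal_sin, Real.cos_pi_div_three, Real.sin_pi_div_three]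
  push_cast; ring

theorem exp_heapArg_parent {i : ℕ} (hi : i ≠ 0) :
    exp (heapArg (i / 2) * I) = exp (heapArg i * I) * (1 / 2 - (-1) ^ i * (√3 / 2) * I) := by
  have h : heapArg (i / 2) = heapArg i + -((-1) ^ i * (Real.pi / 3)) := by
    rw [heapArg_of_ne_zero hi]; ring
  rw [h]
  push_cast
  rw [add_mul, exp_add]
  congr 1
  have h1 : exp ((Real.pi / 3 : ℂ) * I) = 1 / 2 + √3 / 2 * I := by
    simpa only [ofReal_div, ofReal_ofNat] using exp_pi_div_three
  have h2 : exp (-((Real.pi / 3 : ℂ) * I)) = 1 / 2 - √3 / 2 * I := by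
    have h3 : exp (((-(Real.pi / 3) : ℝ) : ℂ) * I) = 1 / 2 - √3 / 2 * I := by
      rw [exp_mul_I, ← ofReal_cos, ← ofReal_sin, Real.cos_neg, Real.sin_neg,
        Real.cos_pi_div_three, Real.sin_pi_div_three]
      push_cast; ring
    push_cast at h3
    rwa [neg_mul] at h3
  rcases Nat.even_or_odd i with hp | hp
  · rw [hp.neg_one_pow, one_mul, one_mul, neg_mul, h2]
  · rw [hp.neg_one_pow]
    simp only [neg_mul, one_mul, neg_neg, sub_neg_eq_add]
    exact h1

/-- The untilted edges. -/
theorem heapPos_sub_heapShift {k : ℕ} {ε : ℝ} {i : ℕ} (h0 : i ≠ 0) (hi : i < 2 ^ (k + 1)) :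
    (heapPos k ε i - heapShift k ε i) - (heapPos k ε (i / 2) - heapShift k ε (i / 2)) =
      (heapEdgeLength i * (Real.cos (tilt k ε (Nat.log 2 i)) +
        (-1) ^ i * (√3 * tiltSin k ε (Nat.log 2 i))) : ℝ) * exp (heapArg i * I) := by
  have hpar : heapShift k ε (i / 2) = 2 * heapEdgeLength i * tiltSin k ε (Nat.log 2 i) *
      (I * exp (heapArg (i / 2) * I)) := by
    by_cases h1 : i / 2 = 0
    · have : i = 1 := by omega
      subst this
      simp [heapShift, tiltSin_zero]
    · have hlog : Nat.log 2 i = Nat.log 2 (i / 2) + 1 :=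
        Nat.log_of_one_lt_of_le one_lt_two (by omega)
      have hlen : heapEdgeLength (i / 2) = 2 * heapEdgeLength i := by
        rw [heapEdgeLength, heapEdgeLength, hlog, pow_succ]; field_simp
      rw [heapShift_eq k ε h1 (by omega), ← hlog, hlen]
      push_cast; ring
  have hpos := heapPos_sub (k := k) (ε := ε) h0
  have hphase : exp (heapPhase k ε i * I) = exp (heapArg i * I) *
      (Real.cos (tilt k ε (Nat.log 2 i)) + Real.sin (tilt k ε (Nat.log 2 i)) * I) := by
    rw [heapPhase, ofReal_add, add_mul, exp_add, exp_mul_I (tilt k ε (Nat.log 2 i) : ℂ),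
      ofReal_cos, ofReal_sin]
  -- The parent's shift has twice the scale and is turned by `π/3`. Its component across the edge
  -- carries `2 cos (π/3) = 1`, so the recursion of `tiltSin` cancels the sine; its component along
  -- the edge carries `± 2 sin (π/3) = ± √3`.
  rw [sub_sub_sub_comm, hpos, hphase, heapShift_eq k ε h0 hi, hpar, exp_heapArg_parent h0,
    tiltSin_succ]
  push_cast
  linear_combination (-(heapEdgeLength i : ℂ) * tiltSin k ε (Nat.log 2 i) *
    exp (heapArg i * I) * (-1) ^ i * √3) * I_sq

theorem dist_heapPos_sub_heapShift {k : ℕ} {ε : ℝ} (hk : 1 ≤ k) (hε : 0 ≤ ε)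
    (h : ε * k ^ 2 ≤ 1) {i : ℕ} (h0 : i ≠ 0) (hi : i < 2 ^ (k + 1)) :
    dist (heapPos k ε i - heapShift k ε i) (heapPos k ε (i / 2) - heapShift k ε (i / 2)) =
      heapEdgeLength i * (Real.cos (tilt k ε (Nat.log 2 i)) +
        (-1) ^ i * (√3 * tiltSin k ε (Nat.log 2 i))) := by
  rw [dist_eq, heapPos_sub_heapShift h0 hi, norm_mul, norm_exp_ofReal_mul_I, mul_one, norm_real,
    Real.norm_of_nonneg]
  refine mul_nonneg (heapEdgeLength_pos i).le ?_
  have hlog : Nat.log 2 i ≤ k := Nat.lt_succ_iff.1 (Nat.log_lt_of_lt_pow h0 hi)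
  have h1 := abs_sqrt_three_mul_tiltSin_le hk hε h hlog
  have h2 : |(-1 : ℝ) ^ i * (√3 * tiltSin k ε (Nat.log 2 i))| =
      |√3 * tiltSin k ε (Nat.log 2 i)| := by
    rw [abs_mul, abs_pow, abs_neg, abs_one, one_pow, one_mul]
  rw [← h2] at h1
  linarith [(abs_le.1 h1).1]

theorem sum_dist_heapPos_sub {k m : ℕ} {ε : ℝ} (hk : 1 ≤ k) (hε : 0 ≤ ε) (h : ε * k ^ 2 ≤ 1)
    (hm : 2 ^ k ≤ m) :
    ∑ i ∈ Finset.Ico 1 (2 * m), (dist (heapPos k ε i) (heapPos k ε (i / 2)) -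
      dist (heapPos k ε i - heapShift k ε i) (heapPos k ε (i / 2) - heapShift k ε (i / 2))) =
      ∑ j ∈ Finset.range (k + 1), (1 - Real.cos (tilt k ε j)) := by
  have hle : 2 ^ (k + 1) ≤ 2 * m := by rw [pow_succ]; omega
  rw [← Finset.sum_Ico_consecutive _ (Nat.one_le_two_pow (n := k + 1)) hle, sum_Ico_two_pow,
    Finset.sum_eq_zero (s := Finset.Ico (2 ^ (k + 1)) (2 * m)), add_zero]
  · refine Finset.sum_congr rfl fun j hj => ?_
    have hterm : ∀ i ∈ Finset.Ico (2 ^ j) (2 ^ (j + 1)),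
        dist (heapPos k ε i) (heapPos k ε (i / 2)) -
          dist (heapPos k ε i - heapShift k ε i)
            (heapPos k ε (i / 2) - heapShift k ε (i / 2)) =
        ((2 : ℝ) ^ j)⁻¹ * (1 - Real.cos (tilt k ε j)) -
          ((2 : ℝ) ^ j)⁻¹ * (√3 * tiltSin k ε j) * (-1) ^ i := by
      intro i hi
      have hlog := log_of_mem_Ico hi
      have hmem := Finset.mem_Ico.1 hi
      have h0 : i ≠ 0 := by have := Nat.one_le_two_pow (n := j); omega
      have hlt : i < 2 ^ (k + 1) := hmem.2.trans_le
        (Nat.pow_le_pow_right two_pos (Finset.mem_range.1 hj))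
      rw [dist_heapPos h0, dist_heapPos_sub_heapShift hk hε h h0 hlt, heapEdgeLength, hlog]
      ring
    rw [Finset.sum_congr rfl hterm, Finset.sum_sub_distrib, ← Finset.mul_sum, Finset.sum_const,
      Nat.card_Ico, nsmul_eq_mul, pow_succ, mul_two, Nat.add_sub_cancel]
    -- Siblings cancel on every level but the top one, whose single edge has `tiltSin k ε 0 = 0`.
    have hzero : ((2 : ℝ) ^ j)⁻¹ * (√3 * tiltSin k ε j) *
        ∑ i ∈ Finset.Ico (2 ^ j) (2 ^ j + 2 ^ j), (-1 : ℝ) ^ i = 0 := by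
      rcases Nat.eq_zero_or_pos j with rfl | hj0
      · simp [tiltSin_zero]
      · obtain ⟨j, rfl⟩ := Nat.exists_eq_succ_of_ne_zero hj0.ne'
        have hsum := sum_Ico_neg_one_pow (2 ^ j) (2 ^ (j + 1))
        rw [← pow_succ', ← pow_succ', pow_succ _ (j + 1), mul_two] at hsum
        rw [hsum, mul_zero]
    rw [← Finset.mul_sum, hzero, sub_zero]
    push_cast
    field_simp
  -- Below depth `k` both endpoints of an edge are unmoved.
  · intro i hi
    have hmem := Finset.mem_Ico.1 hi
    rw [pow_succ] at hmem
    have := Nat.one_le_two_pow (n := k)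
    simp [heapShift, show 2 ^ k ≤ i by omega, show 2 ^ k ≤ i / 2 by omega]

end

/-! ### Realization in the plane and the final bounds -/

/-- The realization of the heap in the Euclidean plane given by complex positions. -/
noncomputable def heapRealization {m : ℕ} (hm : 0 < m) (p : ℕ → ℂ) :
    (heapTopology m hm).Realization 2 :=
  fun i : Fin (2 * m) => Complex.orthonormalBasisOneI.repr (p i.val)

theorem heapRealization_length {m : ℕ} (hm : 0 < m) (p : ℕ → ℂ) :
    (heapTopology m hm).length (heapRealization hm p) =
      ∑ i ∈ Finset.Ico 1 (2 * m), dist (p i) (p (i / 2)) := by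
  refine (heapTopology_length hm fun i => Complex.orthonormalBasisOneI.repr (p i)).trans ?_
  simp only [LinearIsometryEquiv.dist_map]

theorem angle_orthonormalBasisOneI_repr (x y z : ℂ) :
    EuclideanGeometry.angle (Complex.orthonormalBasisOneI.repr x)
      (Complex.orthonormalBasisOneI.repr y) (Complex.orthonormalBasisOneI.repr z) =
      EuclideanGeometry.angle x y z := by
  simp only [EuclideanGeometry.angle, vsub_eq_sub, ← map_sub]
  exact Complex.orthonormalBasisOneI.repr.toLinearIsometry.angle_map _ _

theorem heapRealization_isApproximate {m k : ℕ} (hm : 0 < m) {ε : ℝ} (h0 : 0 ≤ ε) (h1 : ε < 1) :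
    (heapTopology m hm).IsApproximate ε (heapRealization hm (heapPos k ε)) := by
  have hpos {i : ℕ} (hi : i ≠ 0) : heapPos k ε i ≠ heapPos k ε (i / 2) := by
    rw [← dist_pos, dist_heapPos hi]
    exact heapEdgeLength_pos i
  constructor
  · intro u v huv heq
    have h : heapPos k ε (Fin.val u) = heapPos k ε (Fin.val v) :=
      Complex.orthonormalBasisOneI.repr.injective heq
    obtain ⟨hne, hv | hu⟩ := heapGraph_adj.1 huv
    · refine hpos (fun hu0 => hne (Fin.ext (by omega))) (h.trans ?_)
      rw [hv]
    · refine hpos (fun hv0 => hne (Fin.ext (by omega))) (h.symm.trans ?_)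
      rw [hu]
  · intro s hs u v hu hv huv
    have hs' := mt (mem_range_heapTerminal hm s).2 hs
    have hs0 : Fin.val s ≠ 0 := fun h => hs' (Or.inl h)
    have hne : Fin.val u ≠ Fin.val v := fun h => huv (Fin.ext h)
    have hu' := (heapGraph_adj_internal hs0).1 hu
    have hv' := (heapGraph_adj_internal hs0).1 hv
    have e1 := angle_heapPos_left (k := k) h0 h1.le hs0
    have e2 := angle_heapPos_right (k := k) h0 h1 hs0
    have e3 := angle_heapPos_children (k := k) (ε := ε) hs0
    have e1' := (EuclideanGeometry.angle_comm _ _ _).trans e1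
    have e2' := (EuclideanGeometry.angle_comm _ _ _).trans e2
    have e3' := (EuclideanGeometry.angle_comm _ _ _).trans e3
    have key : EuclideanGeometry.angle (heapRealization hm (heapPos k ε) u)
        (heapRealization hm (heapPos k ε) s) (heapRealization hm (heapPos k ε) v) =
        EuclideanGeometry.angle (heapPos k ε (Fin.val u)) (heapPos k ε (Fin.val s))
          (heapPos k ε (Fin.val v)) := angle_orthonormalBasisOneI_repr _ _ _
    rw [key, Set.mem_Icc]
    rcases hu' with hu' | hu' | hu' <;> rcases hv' with hv' | hv' | hv' <;>
      first
      | exact absurd (hu'.trans hv'.symm) hne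
      | (rw [hu', hv']
         simp only [e1, e2, e3, e1', e2', e3']
         constructor <;> linarith)

/-- The relative error of the tilted heap with `m` leaves. -/
theorem steinerRelError_two_ge {m : ℕ} (hm : 2 ≤ m) {ε : ℝ} (h0 : 0 ≤ ε)
    (h : ε * (Nat.log 2 m : ℕ) ^ 2 < 1) :
    (((Nat.log 2 m : ℝ) * (Nat.log 2 m + 1) ^ 2 * ε ^ 2 / 24 / (Nat.log 2 m + 2) : ℝ) : EReal) ≤
      steinerRelError 2 ε (m + 1) := by
  set k := Nat.log 2 m with hkdef
  have hk : 1 ≤ k := Nat.log_pos one_lt_two hm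
  have hk' : (1 : ℝ) ≤ k := by exact_mod_cast hk
  have hm0 : 0 < m := by omega
  have hpow : 2 ^ k ≤ m := Nat.pow_log_le_self 2 hm0.ne'
  have hlt : m < 2 ^ (k + 1) := Nat.lt_pow_succ_log_self one_lt_two m
  have h1 : ε < 1 := by nlinarith [mul_nonneg h0 (by nlinarith : (0 : ℝ) ≤ (k : ℝ) ^ 2 - 1)]
  have hsum := sum_dist_heapPos_sub hk h0 h.le hpow
  have hge := sum_one_sub_cos_tilt_ge hk h0 h.le
  rw [Finset.sum_sub_distrib, ← heapRealization_length hm0,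
    ← heapRealization_length hm0 (fun i => heapPos k ε i - heapShift k ε i)] at hsum
  -- Completing the level of depth `k + 1` gives `k + 2` levels of length `1`.
  have hlen : (heapTopology m hm0).length (heapRealization hm0 (heapPos k ε)) ≤ k + 2 := by
    have hk2 := sum_Ico_inv_two_pow_log (k + 2)
    push_cast at hk2
    rw [heapRealization_length, ← hk2]
    rw [Finset.sum_congr rfl fun i hi => dist_heapPos (by have := Finset.mem_Ico.1 hi; omega)]
    refine Finset.sum_le_sum_of_subset_of_nonneg (Finset.Ico_subset_Ico_right ?_)
      fun i _ _ => (heapEdgeLength_pos i).le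
    rw [pow_succ]; omega
  have hnonneg : 0 ≤ (k : ℝ) * (k + 1) ^ 2 * ε ^ 2 / 24 := by positivity
  have hmem (i : Fin (2 * m)) (hi : m ≤ i.val) : ∃ j, heapTerminal m hm0 j = i :=
    (mem_range_heapTerminal hm0 i).2 (Or.inr hi)
  -- The last two leaves are siblings with parent `m - 1`; they serve as the two distinct terminals.
  obtain ⟨i, hi⟩ := hmem ⟨2 * (m - 1), by omega⟩ (by simp only; omega)
  obtain ⟨j, hj⟩ := hmem ⟨2 * (m - 1) + 1, by omega⟩ (by simp only; omega)
  refine (heapTopology m hm0).le_steinerRelError (heapTopology_isFull hm0)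
    (heapRealization_isApproximate hm0 h0 h1) (q := heapRealization hm0 _)
    (fun l => ?_) (i := i) (j := j) (v := (⟨m - 1, by omega⟩ : Fin (2 * m))) ?_ ?_ ?_ hnonneg
    (hge.trans hsum.ge) (by linarith)
  · refine congrArg Complex.orthonormalBasisOneI.repr ?_
    have hl := (mem_range_heapTerminal hm0 _).1 ⟨l, rfl⟩
    have : heapShift k ε (heapTerminal m hm0 l).val = 0 :=
      if_pos (hl.imp_right fun hl => hpow.trans hl)
    exact sub_eq_self.2 this
  · change (heapGraph m).Adj (heapTerminal m hm0 i) _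
    rw [hi, heapGraph_adj]
    simp only [ne_eq, Fin.ext_iff]
    omega
  · change (heapGraph m).Adj (heapTerminal m hm0 j) _
    rw [hj, heapGraph_adj]
    simp only [ne_eq, Fin.ext_iff]
    omega
  · change Complex.orthonormalBasisOneI.repr _ ≠ Complex.orthonormalBasisOneI.repr _
    rw [show (heapTopology m hm0).terminal i = _ from hi,
      show (heapTopology m hm0).terminal j = _ from hj]
    exact fun heq => heapPos_children_ne (i := m - 1) (by omega)
      (Complex.orthonormalBasisOneI.repr.injective heq)

theorem mainTheorem2 :
    (∀ (k : ℕ) (c ε : ℝ), 1 ≤ k → 0 < c → c < 1 → ε = c / (k : ℝ) ^ 2 →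
      ((c / 24 * ε : ℝ) : EReal) < steinerRelError 2 ε (2 ^ k + 1)) ∧
    (∃ C : ℝ, 0 < C ∧ ∀ (n : ℕ) (ε : ℝ), 3 ≤ n → 0 ≤ ε → ε < (Real.logb 2 (n : ℝ)) ^ (-2 : ℤ) →
      ((C * (Real.log (n : ℝ)) ^ 2 * ε ^ 2 : ℝ) : EReal) ≤ steinerRelError 2 ε n) := by
  constructor
  · intro k c ε hk hc0 hc1 hε
    have hk' : (1 : ℝ) ≤ k := by exact_mod_cast hk
    have hlog : Nat.log 2 (2 ^ k) = k := Nat.log_pow one_lt_two k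
    have hc : c = ε * k ^ 2 := by rw [hε]; field_simp
    have hpos : 0 < ε := by rw [hε]; positivity
    have hmain := steinerRelError_two_ge (m := 2 ^ k) (Nat.le_self_pow (by omega) 2) hpos.le
      (by rw [hlog, ← hc]; exact hc1)
    refine lt_of_lt_of_le ?_ hmain
    -- Strictness comes from `(k + 1)² > k (k + 2)`.
    rw [hlog, EReal.coe_lt_coe_iff, hc, lt_div_iff₀ (by positivity)]
    have : 0 < (k : ℝ) * ε ^ 2 := by positivity
    nlinarith
  -- With `log n ≤ k + 1`, the constant `1/144` only requires `k + 2 ≤ 6k`.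
  · refine ⟨1 / 144, by norm_num, fun n ε hn h0 hε => ?_⟩
    obtain ⟨m, rfl⟩ : ∃ m, n = m + 1 := ⟨n - 1, by omega⟩
    have hm : 2 ≤ m := by omega
    set k := Nat.log 2 m with hkdef
    have hk' : (1 : ℝ) ≤ k := by exact_mod_cast Nat.log_pos one_lt_two hm
    have hpow : (2 : ℝ) ^ k ≤ (m + 1 : ℕ) := by
      exact_mod_cast (Nat.pow_log_le_self 2 (by omega)).trans (Nat.le_succ m)
    have hlt : ((m + 1 : ℕ) : ℝ) ≤ 2 ^ (k + 1) := by
      exact_mod_cast Nat.lt_pow_succ_log_self one_lt_two m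
    have hn0 : (0 : ℝ) < (m + 1 : ℕ) := by positivity
    have hlogb : (k : ℝ) ≤ Real.logb 2 (m + 1 : ℕ) := by
      rw [Real.le_logb_iff_rpow_le one_lt_two hn0, Real.rpow_natCast]
      exact hpow
    have hlog : Real.log (m + 1 : ℕ) ≤ k + 1 := by
      have h2 := Real.log_le_log hn0 hlt
      rw [Real.log_pow] at h2
      push_cast at h2 ⊢
      nlinarith [Real.log_two_lt_d9]
    have hlog0 : 0 ≤ Real.log (m + 1 : ℕ) := Real.log_natCast_nonneg _
    have hsmall : ε * k ^ 2 < 1 := by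
      rw [zpow_neg, show (2 : ℤ) = ((2 : ℕ) : ℤ) from rfl, zpow_natCast, ← one_div,
        lt_div_iff₀ (pow_pos (by linarith) 2)] at hε
      exact (mul_le_mul_of_nonneg_left (pow_le_pow_left₀ (by positivity) hlogb 2) h0).trans_lt hε
    refine le_trans ?_ (steinerRelError_two_ge hm h0 hsmall)
    rw [EReal.coe_le_coe_iff, ← hkdef, le_div_iff₀ (by positivity)]
    have hsq : Real.log (m + 1 : ℕ) ^ 2 * ε ^ 2 ≤ (k + 1) ^ 2 * ε ^ 2 :=
      mul_le_mul_of_nonneg_right (pow_le_pow_left₀ hlog0 hlog 2) (sq_nonneg ε)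
    have hX : 0 ≤ ((k : ℝ) + 1) ^ 2 * ε ^ 2 := by positivity
    nlinarith [mul_le_mul_of_nonneg_right hsq (by positivity : (0 : ℝ) ≤ k + 2)]
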